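/- **Theorem 5 (Undirected Isoperimetric Inequality).** Let $d\ge 0$ be an integer and let $f\colon\{0,1\}^d\to\mathbb{R}$ be any function. Regard $\{0,1\}^d$ as the undirected hypercube, in which $\{x,y\}$ is an edge if and only if $x$ and $y$ differ in exactly one coordinate. For $x\in\{0,1\}^d$ let $$I_f(x)=\bigl|\{\,y : \{x,y\}\text{ is an edge and } f(x)>f(y)\,\}\bigr|,$$ and let $$\mathtt{dist}(f,\mathbf{const})=\min_{c\in\mathbb{R}}\ \Pr_{x\sim\{0,1\}^d}[f(x)\neq c],$$ where $x$ is uniformly distributed on $\{0,1\}^d$. Then $$\mathop{\mathbb{E}}_{x\sim\{0,1\}^d}\Bigl[\sqrt{I_f(x)}\Bigr]\ \ge\ \frac{\mathtt{dist}(f,\mathbf{const})}{2\sqrt2}.$$ -/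

import Mathlib

open scoped BigOperators

/-- The vertex set `{0,1}^d` of the hypercube. -/
abbrev Cube (d : ℕ) : Type := Fin d → Bool

/-- The undirected hypercube graph: `{x, y}` is an edge iff `x` and `y` differ in exactly one
coordinate. -/
def hypercubeGraph (d : ℕ) : SimpleGraph (Cube d) where
  Adj x y := hammingDist x y = 1
  symm := ⟨fun x y h => by rwa [hammingDist_comm]⟩
  loopless := ⟨fun x h => by simp at h⟩

/-- `I_f(x)`: the number of hypercube edges `{x, y}` incident on `x` with `f x > f y`. -/
noncomputable def influence {d : ℕ} (f : Cube d → ℝ) (x : Cube d) : ℕ :=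
  Set.ncard {y : Cube d | (hypercubeGraph d).Adj x y ∧ f x > f y}

/-- `E_x[φ(x)]` for `x` uniform in `{0,1}^d`. -/
noncomputable def cubeExpect {d : ℕ} (φ : Cube d → ℝ) : ℝ :=
  (∑ x : Cube d, φ x) / 2 ^ d

/-- `Pr_x[f(x) ≠ g(x)]` for `x` uniform in `{0,1}^d`. -/
noncomputable def cubeDist {d : ℕ} (f g : Cube d → ℝ) : ℝ :=
  (Set.ncard {x : Cube d | f x ≠ g x} : ℝ) / 2 ^ d

/-- `dist(f, const)`: the least distance from `f` to a constant function. -/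
noncomputable def distConst {d : ℕ} (f : Cube d → ℝ) : ℝ :=
  ⨅ c : ℝ, cubeDist f (fun _ => c)

/-- The infimum defining `distConst` is attained, so it is a minimum. -/
theorem distConst_isLeast {d : ℕ} (f : Cube d → ℝ) :
    IsLeast (Set.range fun c : ℝ => cubeDist f (fun _ => c)) (distConst f) := by
  have hfin : (Set.range fun c : ℝ => cubeDist f (fun _ => c)).Finite := by
    refine ((Set.finite_univ (α := Set (Cube d))).image
      (fun s => (Set.ncard s : ℝ) / 2 ^ d)).subset ?_
    rintro _ ⟨c, rfl⟩
    exact ⟨{x | f x ≠ c}, Set.mem_univ _, rfl⟩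
  exact ⟨(Set.range_nonempty _).csInf_mem hfin, fun _ h => csInf_le hfin.bddBelow h⟩

/-!
Talagrand's inequality `√2 p (1 - p) ≤ E[√h_A]`, for a set `A` of measure `p` with `h_A(x)` edges
leaving `A` at each `x ∈ A`, is proved by induction on the dimension. Cut the cube into two facets
on which `A` has measures `a` and `b`. On the first facet `h_A` is the exit degree of the trace of
`A` plus the indicator of the vertices whose crossing edge leaves `A`, a set of measure at least
`(a - b)⁺`. Minkowski's inequality for the norm `√(u² + v²)` turns this into
`√(J(a)² + ((a - b)⁺)²)`, where `J(p) = √2 p (1 - p)`, and a two-point inequality for `J` closes the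
induction.

For a function `f` with median `m`, each edge leaving `{f > m}` or `{f ≥ m}` descends in `f`, so
`J(Pr[f > m])` and `J(Pr[f ≥ m]) = J(Pr[f < m])` are at most `E[√I_f]`. As `J(p) ≥ p / √2` for
`p ≤ 1/2`, adding the two bounds gives `Pr[f ≠ m] ≤ 2√2 E[√I_f]`.
-/

theorem posPart_sq_add_negPart_sq {R : Type*} [Ring R] [LinearOrder R] [IsOrderedAddMonoid R]
    (a : R) : a⁺ ^ 2 + a⁻ ^ 2 = a ^ 2 := by
  rcases le_total a 0 with h | h
  · simp [posPart_of_nonpos h, negPart_of_nonpos h]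
  · simp [posPart_of_nonneg h, negPart_of_nonneg h]

section IsoProfile

/-- The lower bound `√2 p (1 - p)` for the expected root of the exit degree of a set of uniform
measure `p`. -/
noncomputable def isoProfile (p : ℝ) : ℝ :=
  √2 * (p * (1 - p))

theorem isoProfile_nonneg {p : ℝ} (h0 : 0 ≤ p) (h1 : p ≤ 1) : 0 ≤ isoProfile p :=
  mul_nonneg (Real.sqrt_nonneg 2) (mul_nonneg h0 (sub_nonneg.2 h1))

theorem isoProfile_one_sub (p : ℝ) : isoProfile (1 - p) = isoProfile p := by
  unfold isoProfile
  ring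

theorem div_sqrt_two_le_isoProfile {p : ℝ} (h0 : 0 ≤ p) (h1 : p ≤ 1 / 2) :
    p / √2 ≤ isoProfile p := by
  rw [isoProfile, div_le_iff₀ (by positivity)]
  calc p ≤ 2 * (p * (1 - p)) := by nlinarith
    _ = √2 * √2 * (p * (1 - p)) := by rw [Real.mul_self_sqrt zero_le_two]
    _ = √2 * (p * (1 - p)) * √2 := by ring

theorem isoProfile_add_sq_le_sqrt (p : ℝ) {δ : ℝ} (hδ : δ ^ 2 ≤ 1) :
    isoProfile p + √2 / 2 * δ ^ 2 ≤ √(isoProfile p ^ 2 + δ ^ 2) := by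
  have hp : p * (1 - p) ≤ 1 / 4 := by nlinarith [sq_nonneg (p - 1 / 2)]
  have hgap : 0 ≤ δ ^ 2 * (1 - 2 * (p * (1 - p)) - δ ^ 2 / 2) :=
    mul_nonneg (sq_nonneg δ) (by linarith)
  have hsq : √2 ^ 2 = 2 := Real.sq_sqrt zero_le_two
  refine Real.le_sqrt_of_sq_le ?_
  calc (isoProfile p + √2 / 2 * δ ^ 2) ^ 2
      = isoProfile p ^ 2 + √2 ^ 2 * (p * (1 - p) * δ ^ 2 + δ ^ 4 / 4) := by
        unfold isoProfile
        ring
    _ ≤ isoProfile p ^ 2 + δ ^ 2 := by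
        rw [hsq]
        linarith

theorem isoProfile_midpoint_le {a b : ℝ} (hab : (a - b) ^ 2 ≤ 1) :
    isoProfile ((a + b) / 2) ≤
      (√(isoProfile a ^ 2 + (a - b)⁺ ^ 2) + √(isoProfile b ^ 2 + (b - a)⁺ ^ 2)) / 2 := by
  have hsq : (a - b)⁺ ^ 2 + (b - a)⁺ ^ 2 = (a - b) ^ 2 := by
    rw [← neg_sub a b, posPart_neg, posPart_sq_add_negPart_sq]
  have ha := isoProfile_add_sq_le_sqrt a (δ := (a - b)⁺) (by linarith [sq_nonneg (b - a)⁺])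
  have hb := isoProfile_add_sq_le_sqrt b (δ := (b - a)⁺) (by linarith [sq_nonneg (a - b)⁺])
  calc isoProfile ((a + b) / 2)
      = (isoProfile a + isoProfile b + √2 / 2 * (a - b) ^ 2) / 2 := by
        unfold isoProfile
        ring
    _ = (isoProfile a + √2 / 2 * (a - b)⁺ ^ 2 + (isoProfile b + √2 / 2 * (b - a)⁺ ^ 2)) / 2 := by
        rw [← hsq]
        ring
    _ ≤ _ := by gcongr

end IsoProfile

theorem exists_median {ι α : Type*} [Finite ι] [Nonempty ι] [LinearOrder α] (f : ι → α) :
    ∃ m, 2 * {x | f x < m}.ncard ≤ Nat.card ι ∧ 2 * {x | m < f x}.ncard ≤ Nat.card ι := by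
  let upperHalf : Set ι := {x | 2 * {y | f x < f y}.ncard ≤ Nat.card ι}
  have hne : upperHalf.Nonempty := by
    obtain ⟨x, hx⟩ := Finite.exists_max f
    have hempty : {y | f x < f y} = ∅ := Set.eq_empty_of_forall_notMem fun y => (hx y).not_gt
    exact ⟨x, by simp [upperHalf, hempty]⟩
  obtain ⟨x, hxmem, hxmin⟩ := Set.exists_min_image upperHalf f (Set.toFinite _) hne
  refine ⟨f x, ?_, hxmem⟩
  rcases {y | f y < f x}.eq_empty_or_nonempty with hempty | hbelow
  · simp [hempty]
  obtain ⟨z, hz, hzmax⟩ := Set.exists_max_image {y | f y < f x} f (Set.toFinite _) hbelow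
  have hcompl : {y | f z < f y} = {y | f y < f x}ᶜ := by
    ext y
    exact ⟨fun h hy => (hzmax y hy).not_gt h, fun hy => lt_of_lt_of_le hz (not_lt.1 hy)⟩
  have hzlow : Nat.card ι < 2 * {y | f z < f y}.ncard :=
    not_le.1 fun h => (hxmin z h).not_gt hz
  have hcard := Set.ncard_add_ncard_compl {y | f y < f x}
  rw [hcompl] at hzlow
  omega

section Slice

variable {d : ℕ}

/-- The vertex of `{0,1}^(d+1)` with coordinate `0` equal to `b` and the others given by `x`. -/
abbrev cubeCons (b : Bool) (x : Cube d) : Cube (d + 1) :=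
  Fin.cons b x

/-- The trace of `S ⊆ {0,1}^(d+1)` on the facet where coordinate `0` equals `b`, viewed as a subset
of `{0,1}^d`. -/
def slice (b : Bool) (S : Set (Cube (d + 1))) : Set (Cube d) :=
  cubeCons b ⁻¹' S

theorem cubeCons_injective (b : Bool) : Function.Injective (cubeCons b : Cube d → Cube (d + 1)) :=
  Fin.cons_right_injective (α := fun _ => Bool) b

theorem ncard_slice_add_ncard_slice_not (b : Bool) (S : Set (Cube (d + 1))) :
    (slice b S).ncard + (slice (!b) S).ncard = S.ncard := by
  have hdisj : Disjoint (cubeCons b '' slice b S) (cubeCons (!b) '' slice (!b) S) := by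
    rw [Set.disjoint_left]
    rintro _ ⟨x, -, rfl⟩ ⟨y, -, hy⟩
    simpa using congrFun hy 0
  rw [← Set.ncard_image_of_injective (slice b S) (cubeCons_injective b),
    ← Set.ncard_image_of_injective (slice (!b) S) (cubeCons_injective (!b)),
    ← Set.ncard_union_eq hdisj]
  congr 1
  ext y
  constructor
  · rintro (⟨x, hx, rfl⟩ | ⟨x, hx, rfl⟩) <;> exact hx
  · intro hy
    rw [← Fin.cons_self_tail y] at hy ⊢
    rcases Bool.eq_or_eq_not (y 0) b with h | h <;> rw [h] at hy ⊢
    · exact Or.inl ⟨_, hy, rfl⟩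
    · exact Or.inr ⟨_, hy, rfl⟩

theorem hypercubeGraph_adj_cubeCons_iff (b : Bool) (x y : Cube d) :
    (hypercubeGraph (d + 1)).Adj (cubeCons b x) (cubeCons b y) ↔ (hypercubeGraph d).Adj x y := by
  simp [hypercubeGraph, hammingDist, Fin.card_filter_univ_succ]

theorem hypercubeGraph_adj_cubeCons_not_iff (b : Bool) (x y : Cube d) :
    (hypercubeGraph (d + 1)).Adj (cubeCons b x) (cubeCons (!b) y) ↔ y = x := by
  rw [← hammingDist_eq_zero]
  simp [hypercubeGraph, hammingDist, Fin.card_filter_univ_succ, eq_comm]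

end Slice

section Expectation

variable {d : ℕ}

theorem cubeExpect_mono {φ ψ : Cube d → ℝ} (h : ∀ x, φ x ≤ ψ x) :
    cubeExpect φ ≤ cubeExpect ψ :=
  div_le_div_of_nonneg_right (Finset.sum_le_sum fun x _ => h x) (by positivity)

theorem cubeExpect_nonneg {φ : Cube d → ℝ} (h : ∀ x, 0 ≤ φ x) : 0 ≤ cubeExpect φ :=
  div_nonneg (Finset.sum_nonneg fun x _ => h x) (by positivity)

theorem cubeExpect_succ (φ : Cube (d + 1) → ℝ) :
    cubeExpect φ = (cubeExpect (fun x => φ (cubeCons true x)) +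
      cubeExpect (fun x => φ (cubeCons false x))) / 2 := by
  unfold cubeExpect
  rw [← (Fin.consEquiv fun _ : Fin (d + 1) => Bool).sum_comp, Fintype.sum_prod_type,
    Fintype.sum_bool, ← add_div, div_div, ← pow_succ]
  rfl

theorem sqrt_cubeExpect_sq_add_sq_le (u v : Cube d → ℝ) :
    √(cubeExpect u ^ 2 + cubeExpect v ^ 2) ≤ cubeExpect fun x => √(u x ^ 2 + v x ^ 2) := by
  -- The triangle inequality for the complex numbers `u x + v x * I`.
  have h := norm_sum_le Finset.univ fun x => (⟨u x, v x⟩ : ℂ)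
  simp only [Complex.norm_eq_sqrt_sq_add_sq, Complex.re_sum, Complex.im_sum] at h
  unfold cubeExpect
  rw [div_pow, div_pow, ← add_div, Real.sqrt_div' _ (by positivity), Real.sqrt_sq (by positivity)]
  exact div_le_div_of_nonneg_right h (by positivity)

end Expectation

section Measure

variable {d : ℕ}

/-- The uniform probability `Pr_x[x ∈ A]` of a set of vertices; `cubeDist f g` is by definition
`cubeMeasure {x | f x ≠ g x}`. -/
noncomputable def cubeMeasure (A : Set (Cube d)) : ℝ :=
  A.ncard / 2 ^ d

theorem cubeMeasure_nonneg (A : Set (Cube d)) : 0 ≤ cubeMeasure A :=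
  div_nonneg (Nat.cast_nonneg _) (by positivity)

theorem cubeMeasure_univ : cubeMeasure (Set.univ : Set (Cube d)) = 1 := by
  simp [cubeMeasure, Set.ncard_univ]

theorem cubeMeasure_empty : cubeMeasure (∅ : Set (Cube d)) = 0 := by
  simp [cubeMeasure]

theorem cubeMeasure_add_compl (A : Set (Cube d)) : cubeMeasure A + cubeMeasure Aᶜ = 1 := by
  rw [← cubeMeasure_univ, cubeMeasure, cubeMeasure, cubeMeasure, ← add_div, Set.ncard_univ,
    ← Set.ncard_add_ncard_compl A, Nat.cast_add]

theorem isoProfile_cubeMeasure_compl (A : Set (Cube d)) :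
    isoProfile (cubeMeasure Aᶜ) = isoProfile (cubeMeasure A) := by
  rw [← isoProfile_one_sub, ← cubeMeasure_add_compl A, add_sub_cancel_right]

theorem cubeMeasure_le_one (A : Set (Cube d)) : cubeMeasure A ≤ 1 := by
  linarith [cubeMeasure_add_compl A, cubeMeasure_nonneg Aᶜ]

theorem cubeMeasure_union_le (A B : Set (Cube d)) :
    cubeMeasure (A ∪ B) ≤ cubeMeasure A + cubeMeasure B := by
  unfold cubeMeasure
  rw [← add_div]
  gcongr
  exact_mod_cast Set.ncard_union_le A B

theorem cubeMeasure_sub_le_cubeMeasure_sdiff (A B : Set (Cube d)) :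
    cubeMeasure A - cubeMeasure B ≤ cubeMeasure (A \ B) := by
  unfold cubeMeasure
  rw [← sub_div]
  gcongr
  rw [sub_le_iff_le_add]
  exact_mod_cast Set.ncard_le_ncard_sdiff_add_ncard A B

theorem cubeMeasure_le_half {A : Set (Cube d)} (h : 2 * A.ncard ≤ Nat.card (Cube d)) :
    cubeMeasure A ≤ 1 / 2 := by
  have hcard : Nat.card (Cube d) = 2 ^ d := by simp
  have hcast : 2 * (A.ncard : ℝ) ≤ 2 ^ d := by exact_mod_cast hcard ▸ h
  rw [cubeMeasure, div_le_iff₀ (by positivity)]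
  linarith

theorem cubeMeasure_succ (A : Set (Cube (d + 1))) :
    cubeMeasure A = (cubeMeasure (slice true A) + cubeMeasure (slice false A)) / 2 := by
  unfold cubeMeasure
  rw [← ncard_slice_add_ncard_slice_not true A, ← add_div, div_div, ← pow_succ, Nat.cast_add,
    Bool.not_true]

theorem cubeExpect_indicator_one (A : Set (Cube d)) :
    cubeExpect (A.indicator 1) = cubeMeasure A := by
  classical
  rw [cubeExpect, cubeMeasure, Finset.sum_indicator_eq_sum_filter, Set.ncard_eq_toFinset_card']
  simp

end Measure

section ExitDegree

variable {d : ℕ}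

/-- The neighbours of `x` reached by the edges that leave `A` at `x`; none if `x ∉ A`. -/
def exitNeighbors (A : Set (Cube d)) (x : Cube d) : Set (Cube d) :=
  {y | (hypercubeGraph d).Adj x y ∧ x ∈ A ∧ y ∉ A}

/-- The number `h_A(x)` of edges that leave `A` at `x`, the quantity in Talagrand's inequality. -/
noncomputable def exitDegree (A : Set (Cube d)) (x : Cube d) : ℕ :=
  (exitNeighbors A x).ncard

theorem slice_exitNeighbors_cubeCons (A : Set (Cube (d + 1))) (b : Bool) (x : Cube d) :
    slice b (exitNeighbors A (cubeCons b x)) = exitNeighbors (slice b A) x :=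
  Set.ext fun y => and_congr_left' (hypercubeGraph_adj_cubeCons_iff b x y)

theorem slice_not_exitNeighbors_cubeCons (A : Set (Cube (d + 1))) (b : Bool) (x : Cube d) :
    slice (!b) (exitNeighbors A (cubeCons b x)) = {x} ∩ (slice b A \ slice (!b) A) := by
  ext y
  refine (and_congr_left' (hypercubeGraph_adj_cubeCons_not_iff b x y)).trans
    (and_congr_right ?_)
  rintro rfl
  rfl

theorem exitDegree_cubeCons (A : Set (Cube (d + 1))) (b : Bool) (x : Cube d) :
    (exitDegree A (cubeCons b x) : ℝ) =
      exitDegree (slice b A) x + (slice b A \ slice (!b) A).indicator 1 x := by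
  rw [exitDegree, ← ncard_slice_add_ncard_slice_not b, slice_exitNeighbors_cubeCons,
    slice_not_exitNeighbors_cubeCons, Nat.cast_add, exitDegree]
  congr 1
  by_cases hx : x ∈ slice b A \ slice (!b) A
  · rw [Set.inter_eq_left.2 (Set.singleton_subset_iff.2 hx), Set.indicator_of_mem hx]
    simp
  · rw [Set.singleton_inter_eq_empty.2 hx, Set.indicator_of_notMem hx]
    simp

theorem sqrt_sq_add_posPart_sq_le_cubeExpect_sqrt_exitDegree_cubeCons
    (A : Set (Cube (d + 1))) (b : Bool) {r : ℝ} (hr : 0 ≤ r)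
    (h : r ≤ cubeExpect fun x => √(exitDegree (slice b A) x)) :
    √(r ^ 2 + (cubeMeasure (slice b A) - cubeMeasure (slice (!b) A))⁺ ^ 2) ≤
      cubeExpect fun x => √(exitDegree A (cubeCons b x)) := by
  set crossing : Set (Cube d) := slice b A \ slice (!b) A
  have hcrossing : (cubeMeasure (slice b A) - cubeMeasure (slice (!b) A))⁺ ≤
      cubeExpect (crossing.indicator 1) := by
    rw [cubeExpect_indicator_one]
    exact sup_le (cubeMeasure_sub_le_cubeMeasure_sdiff _ _) (cubeMeasure_nonneg _)
  have hsq (x : Cube d) : (crossing.indicator 1 x : ℝ) ^ 2 = crossing.indicator 1 x := by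
    by_cases hx : x ∈ crossing <;> simp [hx]
  calc √(r ^ 2 + (cubeMeasure (slice b A) - cubeMeasure (slice (!b) A))⁺ ^ 2)
      ≤ √((cubeExpect fun x => √(exitDegree (slice b A) x)) ^ 2 +
          cubeExpect (crossing.indicator 1) ^ 2) := by gcongr
    _ ≤ cubeExpect fun x => √(√(exitDegree (slice b A) x) ^ 2 + crossing.indicator 1 x ^ 2) :=
        sqrt_cubeExpect_sq_add_sq_le _ _
    _ = cubeExpect fun x => √(exitDegree A (cubeCons b x)) := by
        simp only [Real.sq_sqrt (Nat.cast_nonneg _), hsq, exitDegree_cubeCons, crossing]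

theorem isoProfile_cubeMeasure_le_cubeExpect_sqrt_exitDegree (A : Set (Cube d)) :
    isoProfile (cubeMeasure A) ≤ cubeExpect fun x => √(exitDegree A x) := by
  induction d with
  | zero =>
    have hzero : isoProfile (cubeMeasure A) = 0 := by
      rcases Set.eq_empty_or_nonempty A with rfl | hA
      · simp [isoProfile, cubeMeasure_empty]
      · simp [isoProfile, Subsingleton.eq_univ_of_nonempty hA, cubeMeasure_univ]
    exact hzero.trans_le (cubeExpect_nonneg fun x => Real.sqrt_nonneg _)
  | succ d ih =>
    set p := cubeMeasure (slice true A)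
    set q := cubeMeasure (slice false A)
    have hp0 : 0 ≤ p := cubeMeasure_nonneg _
    have hp1 : p ≤ 1 := cubeMeasure_le_one _
    have hq0 : 0 ≤ q := cubeMeasure_nonneg _
    have hq1 : q ≤ 1 := cubeMeasure_le_one _
    calc isoProfile (cubeMeasure A) = isoProfile ((p + q) / 2) := by rw [cubeMeasure_succ]
      _ ≤ (√(isoProfile p ^ 2 + (p - q)⁺ ^ 2) + √(isoProfile q ^ 2 + (q - p)⁺ ^ 2)) / 2 :=
          isoProfile_midpoint_le (by nlinarith)
      _ ≤ (cubeExpect (fun x => √(exitDegree A (cubeCons true x))) +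
            cubeExpect (fun x => √(exitDegree A (cubeCons false x)))) / 2 := by
          gcongr
          · exact sqrt_sq_add_posPart_sq_le_cubeExpect_sqrt_exitDegree_cubeCons A true
              (isoProfile_nonneg hp0 hp1) (ih _)
          · exact sqrt_sq_add_posPart_sq_le_cubeExpect_sqrt_exitDegree_cubeCons A false
              (isoProfile_nonneg hq0 hq1) (ih _)
      _ = cubeExpect fun x => √(exitDegree A x) := by rw [cubeExpect_succ]

end ExitDegree

section LinearOrder

variable {d : ℕ} {α : Type*} [LinearOrder α]

/-- `I_f(x)` for a function `f` with values in any linear order; for real-valued `f` this is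
`influence f x` by definition. -/
noncomputable def orderInfluence (f : Cube d → α) (x : Cube d) : ℕ :=
  {y | (hypercubeGraph d).Adj x y ∧ f x > f y}.ncard

theorem exitDegree_preimage_le_orderInfluence (f : Cube d → α) {s : Set α} (hs : IsUpperSet s)
    (x : Cube d) : exitDegree (f ⁻¹' s) x ≤ orderInfluence f x :=
  Set.ncard_le_ncard fun _ ⟨hadj, hx, hy⟩ => ⟨hadj, not_le.1 fun hle => hy (hs hle hx)⟩

theorem isoProfile_cubeMeasure_preimage_le (f : Cube d → α) {s : Set α} (hs : IsUpperSet s) :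
    isoProfile (cubeMeasure (f ⁻¹' s)) ≤ cubeExpect fun x => √(orderInfluence f x) :=
  (isoProfile_cubeMeasure_le_cubeExpect_sqrt_exitDegree _).trans <| cubeExpect_mono fun x =>
    Real.sqrt_le_sqrt (by exact_mod_cast exitDegree_preimage_le_orderInfluence f hs x)

theorem cubeMeasure_gt_div_sqrt_two_le (f : Cube d → α) {m : α}
    (hm : 2 * {x | m < f x}.ncard ≤ Nat.card (Cube d)) :
    cubeMeasure {x | m < f x} / √2 ≤ cubeExpect fun x => √(orderInfluence f x) :=
  (div_sqrt_two_le_isoProfile (cubeMeasure_nonneg _) (cubeMeasure_le_half hm)).trans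
    (isoProfile_cubeMeasure_preimage_le f (isUpperSet_Ioi m))

theorem cubeMeasure_lt_div_sqrt_two_le (f : Cube d → α) {m : α}
    (hm : 2 * {x | f x < m}.ncard ≤ Nat.card (Cube d)) :
    cubeMeasure {x | f x < m} / √2 ≤ cubeExpect fun x => √(orderInfluence f x) := by
  have hcompl : f ⁻¹' Set.Ici m = {x | f x < m}ᶜ := Set.ext fun x => not_lt.symm
  have h := isoProfile_cubeMeasure_preimage_le f (isUpperSet_Ici m)
  rw [hcompl, isoProfile_cubeMeasure_compl] at h
  exact (div_sqrt_two_le_isoProfile (cubeMeasure_nonneg _) (cubeMeasure_le_half hm)).trans h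

theorem cubeMeasure_ne_le (f : Cube d → α) (m : α) :
    cubeMeasure {x | f x ≠ m} ≤ cubeMeasure {x | f x < m} + cubeMeasure {x | m < f x} := by
  have hunion : {x | f x ≠ m} = {x | f x < m} ∪ {x | m < f x} := Set.ext fun x => ne_iff_lt_or_gt
  exact hunion ▸ cubeMeasure_union_le _ _

theorem theorem5_general (f : Cube d → α) :
    ∃ m, cubeMeasure {x | f x ≠ m} / (2 * √2) ≤ cubeExpect fun x => √(orderInfluence f x) := by
  obtain ⟨m, hlower, hupper⟩ := exists_median f
  refine ⟨m, ?_⟩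
  calc cubeMeasure {x | f x ≠ m} / (2 * √2)
      ≤ (cubeMeasure {x | f x < m} + cubeMeasure {x | m < f x}) / (2 * √2) := by
        gcongr
        exact cubeMeasure_ne_le f m
    _ = (cubeMeasure {x | f x < m} / √2 + cubeMeasure {x | m < f x} / √2) / 2 := by ring
    _ ≤ cubeExpect fun x => √(orderInfluence f x) := by
        linarith [cubeMeasure_lt_div_sqrt_two_le f hlower, cubeMeasure_gt_div_sqrt_two_le f hupper]

end LinearOrder

theorem theorem5 (d : ℕ) (f : Cube d → ℝ) :
    cubeExpect (fun x => Real.sqrt (influence f x)) ≥ distConst f / (2 * Real.sqrt 2) := by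
  obtain ⟨m, hm⟩ := theorem5_general f
  exact (div_le_div_of_nonneg_right ((distConst_isLeast f).2 ⟨m, rfl⟩) (by positivity)).trans hm
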